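/- Let $m$ states have relative sizes $p_1,\dots,p_m\ge 0$ with $\sum_{i=1}^m p_i=1$, and assume that $p_1,\dots,p_m$ are linearly independent over $\mathbb{Q}$. For $n\ge 1$ let $s_i(n)$ be the number of seats that state $i$ receives when $n$ seats are distributed by Hamilton's method (largest remainders): state $i$ first receives $\lfloor np_i\rfloor$ seats, and the remaining $n-\sum_j\lfloor np_j\rfloor$ seats go, one each, to the states with the largest remainders $np_i-\lfloor np_i\rfloor$. State $i$ suffers from the Alabama paradox when the number of seats increases from $n$ to $n+1$ if $s_i(n+1)<s_i(n)$. Let $q_i=\lim_{N\to\infty}\frac1N\#\{1\le n<N: s_i(n+1)<s_i(n)\}$ be the probability that state $i$ suffers from the paradox, and let the expected number of states that suffer from the paradox when the number of seats increases by one be $E=\lim_{N\to\infty}\frac1N\sum_{n=1}^N\#\{i: s_i(n+1)<s_i(n)\}$. (i) All these limits exist, $E=\sum_{i=1}^m q_i$, and $$E<\frac1e .$$ (ii) The bound is approached in the following regime. Take a sequence of such systems, the $k$-th one with $m_k$ states, relative sizes $p_{k,1},\dots,p_{k,m_k}$ as above and expected number $E_k$, and let $m_k\to\infty$. Suppose that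 there are sets $A_k\subseteq\{1,\dots,m_k\}$ of very small states such that $m_k-|A_k|=o(m_k)$, $\max_{i\in A_k}p_{k,i}=o(1/m_k)$ and $\max_{i\notin A_k}p_{k,i}=o(1)$ as $k\to\infty$ (a maximum over the empty set being $0$). Then $E_k\to 1/e$. -/

import Mathlib

open Filter Topology

namespace Hamilton

/-- Exact proportional share `μ_i = n p_i` of state `i` when `n` seats are distributed among
`m` states of relative sizes `p`. -/
noncomputable def quota {m : ℕ} (p : Fin m → ℝ) (n : ℕ) (i : Fin m) : ℝ := n * p i

/-- The number of seats that remain after every state has received `⌊μ_j⌋` seats. -/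
noncomputable def remaining {m : ℕ} (p : Fin m → ℝ) (n : ℕ) : ℤ :=
  (n : ℤ) - ∑ j, ⌊quota p n j⌋

/-- The states that come before state `i` in the order of decreasing remainders `μ_j - ⌊μ_j⌋`.
Ties are broken by the index, as a fixed priority list. -/
noncomputable def ahead {m : ℕ} (p : Fin m → ℝ) (n : ℕ) (i : Fin m) : Finset (Fin m) :=
  Finset.univ.filter fun j =>
    Int.fract (quota p n i) < Int.fract (quota p n j) ∨
      (Int.fract (quota p n j) = Int.fract (quota p n i) ∧ j < i)

/-- Hamilton's method (largest remainders): state `i` receives `⌊μ_i⌋` seats, and one more if it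
is among the states with the largest remainders, as many as there are remaining seats. -/
noncomputable def seats {m : ℕ} (p : Fin m → ℝ) (n : ℕ) (i : Fin m) : ℤ :=
  ⌊quota p n i⌋ + if ((ahead p n i).card : ℤ) < remaining p n then 1 else 0

/-- State `i` suffers from the Alabama paradox when the number of seats increases
from `n` to `n + 1`. -/
def Suffers {m : ℕ} (p : Fin m → ℝ) (n : ℕ) (i : Fin m) : Prop :=
  seats p (n + 1) i < seats p n i

open scoped Classical in
/-- `ν_i(N)`: the number of `n` with `1 ≤ n < N` such that state `i` suffers from the Alabama
paradox when the number of seats increases from `n` to `n + 1`. -/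
noncomputable def sufferCount {m : ℕ} (p : Fin m → ℝ) (i : Fin m) (N : ℕ) : ℕ :=
  ((Finset.Ico 1 N).filter fun n => Suffers p n i).card

/-- `q` is the probability that state `i` suffers from the Alabama paradox: `ν_i(N) / N → q`. -/
def IsAlabamaProbability {m : ℕ} (p : Fin m → ℝ) (i : Fin m) (q : ℝ) : Prop :=
  Tendsto (fun N : ℕ => (sufferCount p i N : ℝ) / N) atTop (𝓝 q)

open scoped Classical in
/-- The number of states that suffer when the number of seats increases from `n` to `n + 1`. -/
noncomputable def numSuffering {m : ℕ} (p : Fin m → ℝ) (n : ℕ) : ℕ :=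
  (Finset.univ.filter fun i => Suffers p n i).card

/-- `E` is the expected number of states that suffer from the Alabama paradox when the number of
seats increases by one: the limit, as `N → ∞`, of the mean of `numSuffering p n` for `n` uniform
on `{1, …, N}`. -/
def IsExpectedNumber {m : ℕ} (p : Fin m → ℝ) (E : ℝ) : Prop :=
  Tendsto (fun N : ℕ => (∑ n ∈ Finset.Icc 1 N, (numSuffering p n : ℝ)) / N) atTop (𝓝 E)

/-- `p` lists the relative sizes of `m` states, and they are linearly independent over `ℚ`. -/
structure IsIndependentSizes {m : ℕ} (p : Fin m → ℝ) : Prop where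
  nonneg : ∀ i, 0 ≤ p i
  sum_eq_one : ∑ i, p i = 1
  linearIndependent : LinearIndependent ℚ p

end Hamilton

/-! Fix a state `i` and put `c_j = p_j - p_i`. The level `m{n p_i} + ∑ {n c_j}` is an integer, and
`i` is rounded up iff it is at least `m`. If the remainder of `i` does not wrap, one more seat
changes the level by `1 - W`, where `W` is the net number of overtakings of `i` by other states. So
`i` suffers iff the level is at least `m` and drops below `m` (`suffers_iff_level`).

By independence the multiples of `(p_j)_{j ≠ i}` equidistribute on a torus, so `q_i` is the Haar
measure of a set (`tendsto_orbit_frequency`). Diagonal translation by `s/m` fixes all differences,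
hence `W`, while the level runs through all residues mod `m`; exactly `(W - 1)⁺` of the `m`
translates lie in the set. Hence `q_i = E[(W - 1)⁺] / m` (`measureReal_paradoxSet`).

`W` is a sum of independent terms whose positive parts `B_j` are Bernoulli of mean `max(c_j, 0)`,
and `(∑ B_j - 1)⁺ = ∑ B_j - 1 + ∏ (1 - B_j)`. With `a = ∑ max(c_j, 0) < 1` this gives `E[(W - 1)⁺] ≤
a - 1 + e^{-a} < 1/e` (`excess_drift_lt`), and averaging over `i` proves (i). Conversely `E[(W -
1)⁺] ≥ -m p_i + ∏ (1 - max(c_j, 0))`, which is close to `1/e` when `m p_i` and all sizes are small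
(`le_excess_drift`); almost all states are of this kind in (ii). -/

namespace Hamilton

open MeasureTheory UnitAddTorus

/-! ### Weyl equidistribution on the torus -/

section Equidistribution

/-- Averages of the powers of a complex number `w ≠ 1` of modulus one tend to zero. -/
lemma tendsto_average_pow {w : ℂ} (hw : ‖w‖ = 1) (h1 : w ≠ 1) :
    Tendsto (fun N : ℕ => ((N : ℂ) + 1)⁻¹ * ∑ n ∈ Finset.range (N + 1), w ^ (n + 1)) atTop
      (𝓝 0) := by
  have h2 : w - 1 ≠ 0 := sub_ne_zero.2 h1
  refine squeeze_zero_norm (a := fun N : ℕ => (2 / ‖w - 1‖) * (1 / ((N : ℝ) + 1))) (fun N => ?_) ?_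
  · simp_rw [pow_succ]
    rw [← Finset.sum_mul, geom_sum_eq h1, norm_mul, norm_mul, norm_div, hw, mul_one, norm_inv,
      mul_comm, one_div]
    have h3 : ‖w ^ (N + 1) - 1‖ ≤ 2 := by
      refine (norm_sub_le _ _).trans ?_
      rw [norm_pow, hw]; norm_num
    have h4 : ‖(N : ℂ) + 1‖ = (N : ℝ) + 1 := by
      rw [← Nat.cast_succ, Complex.norm_natCast, Nat.cast_succ]
    rw [h4]
    gcongr
  · simpa using (tendsto_one_div_add_atTop_nhds_zero_nat (𝕜 := ℝ)).const_mul (2 / ‖w - 1‖)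

variable {d : Type*} [Fintype d]

/-- The Haar probability measure on the torus. -/
noncomputable abbrev torusMeasure (d : Type*) [Fintype d] : Measure (UnitAddTorus d) :=
  Measure.pi fun _ => AddCircle.haarAddCircle

lemma mFourier_apply_add (k : d → ℤ) (x y : UnitAddTorus d) :
    mFourier k (x + y) = mFourier k x * mFourier k y := by
  simp [mFourier, fourier_apply, smul_add, AddCircle.toCircle_add, Finset.prod_mul_distrib]

lemma mFourier_apply_nsmul (k : d → ℤ) (x : UnitAddTorus d) (n : ℕ) :
    mFourier k (n • x) = mFourier k x ^ n := by
  induction n with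
  | zero => simp [mFourier]
  | succ n ih => rw [succ_nsmul, mFourier_apply_add, ih, pow_succ]

lemma norm_mFourier_apply (k : d → ℤ) (x : UnitAddTorus d) : ‖mFourier k x‖ = 1 := by
  simp only [mFourier, ContinuousMap.coe_mk, fourier_apply, norm_prod]
  exact Finset.prod_eq_one fun b _ => Circle.norm_coe _

/-- Translation by `a` preserves the integral but multiplies it by `mFourier k a`. -/
lemma integral_mFourier_eq_zero {k : d → ℤ} {a : UnitAddTorus d} (h : mFourier k a ≠ 1) :
    ∫ x, mFourier k x ∂(torusMeasure d) = 0 := by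
  have h1 : ∫ x, mFourier k (x + a) ∂(torusMeasure d) = ∫ x, mFourier k x ∂(torusMeasure d) :=
    integral_add_right_eq_self (fun x => mFourier k x) a
  simp_rw [mFourier_apply_add, integral_mul_const] at h1
  by_contra h0
  exact h (mul_left_cancel₀ h0 (by rw [h1, mul_one]))

lemma integrable_continuousMap (f : C(UnitAddTorus d, ℂ)) : Integrable f (torusMeasure d) :=
  f.continuous.integrable_of_hasCompactSupport (HasCompactSupport.of_compactSpace _)

/-- Weyl's equidistribution theorem on the torus, for continuous functions. -/
theorem tendsto_orbit_average {α : UnitAddTorus d}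
    (hα : ∀ k : d → ℤ, k ≠ 0 → mFourier k α ≠ 1) (f : C(UnitAddTorus d, ℂ)) :
    Tendsto (fun N : ℕ => ((N : ℂ) + 1)⁻¹ * ∑ n ∈ Finset.range (N + 1), f ((n + 1) • α)) atTop
      (𝓝 (∫ x, f x ∂(torusMeasure d))) := by
  have hspan : ∀ g ∈ Submodule.span ℂ (Set.range (mFourier (d := d))),
      Tendsto (fun N : ℕ => ((N : ℂ) + 1)⁻¹ * ∑ n ∈ Finset.range (N + 1), g ((n + 1) • α)) atTop
        (𝓝 (∫ x, g x ∂(torusMeasure d))) := by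
    intro g hg
    induction hg using Submodule.span_induction with
    | mem g hg =>
      obtain ⟨k, rfl⟩ := hg
      by_cases hk : k = 0
      · subst hk
        have : ∀ N : ℕ, (N : ℂ) + 1 ≠ 0 := fun N => Nat.cast_add_one_ne_zero N
        simp [mFourier_zero, this]
      · rw [integral_mFourier_eq_zero (hα k hk)]
        simp_rw [mFourier_apply_nsmul]
        exact tendsto_average_pow (norm_mFourier_apply k α) (hα k hk)
    | zero => simp
    | add f g _ _ hf hg =>
      have := hf.add hg
      simp only [ContinuousMap.add_apply, Finset.sum_add_distrib, mul_add]
      rwa [integral_add (integrable_continuousMap f) (integrable_continuousMap g)]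
    | smul c f _ hf =>
      have := hf.const_mul c
      simp only [ContinuousMap.smul_apply, smul_eq_mul, ← Finset.mul_sum, integral_const_mul]
      refine this.congr fun N => by ring
  rw [Metric.tendsto_atTop]
  intro ε hε
  -- Trigonometric polynomials are uniformly dense, and both averages and integrals are 1-Lipschitz
  -- in the sup norm.
  have hmem : f ∈ closure (Submodule.span ℂ (Set.range (mFourier (d := d))) : Set _) := by
    rw [← Submodule.topologicalClosure_coe, span_mFourier_closure_eq_top]; trivial
  obtain ⟨g, hg, hfg⟩ := Metric.mem_closure_iff.1 hmem (ε / 3) (by positivity)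
  obtain ⟨N₀, hN₀⟩ := Metric.tendsto_atTop.1 (hspan g hg) (ε / 3) (by positivity)
  refine ⟨N₀, fun N hN => ?_⟩
  have hpt : ∀ x, ‖f x - g x‖ ≤ ε / 3 := fun x => by
    rw [← dist_eq_norm]; exact (ContinuousMap.dist_apply_le_dist x).trans hfg.le
  have h1 : dist (((N : ℂ) + 1)⁻¹ * ∑ n ∈ Finset.range (N + 1), f ((n + 1) • α))
      (((N : ℂ) + 1)⁻¹ * ∑ n ∈ Finset.range (N + 1), g ((n + 1) • α)) ≤ ε / 3 := by
    rw [dist_eq_norm, ← mul_sub, ← Finset.sum_sub_distrib, norm_mul, norm_inv]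
    have h4 : ‖(N : ℂ) + 1‖ = (N : ℝ) + 1 := by
      rw [← Nat.cast_succ, Complex.norm_natCast, Nat.cast_succ]
    rw [h4, inv_mul_le_iff₀ (by positivity)]
    refine (norm_sum_le_of_le _ fun n _ => hpt _).trans (le_of_eq ?_)
    simp
  have h2 : dist (∫ x, g x ∂(torusMeasure d)) (∫ x, f x ∂(torusMeasure d)) ≤ ε / 3 := by
    rw [dist_comm, dist_eq_norm,
      ← integral_sub (integrable_continuousMap f) (integrable_continuousMap g)]
    refine (norm_integral_le_of_norm_le_const (Eventually.of_forall hpt)).trans (le_of_eq ?_)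
    simp
  have h3 := hN₀ N hN
  have h5 := dist_triangle4 (((N : ℂ) + 1)⁻¹ * ∑ n ∈ Finset.range (N + 1), f ((n + 1) • α))
    (((N : ℂ) + 1)⁻¹ * ∑ n ∈ Finset.range (N + 1), g ((n + 1) • α))
    (∫ x, g x ∂(torusMeasure d)) (∫ x, f x ∂(torusMeasure d))
  linarith

open scoped ENNReal in
/-- The uniform probability measure on the first `N + 1` terms of a sequence. -/
noncomputable def empiricalMeasure {X : Type*} [MeasurableSpace X] (x : ℕ → X) (N : ℕ) :
    ProbabilityMeasure X :=
  ⟨((N : ℝ≥0∞) + 1)⁻¹ • ∑ n ∈ Finset.range (N + 1), Measure.dirac (x n), ⟨by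
    simp [Measure.finsetSum_apply]
    exact ENNReal.inv_mul_cancel (by simp) (by simp)⟩⟩

/-- `torusMeasure` as a bundled probability measure. -/
noncomputable def torusProbability (d : Type*) [Fintype d] :
    ProbabilityMeasure (UnitAddTorus d) :=
  ⟨torusMeasure d, inferInstance⟩

/-- Weyl's equidistribution theorem on the torus, for sets with negligible boundary. -/
theorem tendsto_orbit_frequency {α : UnitAddTorus d}
    (hα : ∀ k : d → ℤ, k ≠ 0 → mFourier k α ≠ 1) {s : Set (UnitAddTorus d)}
    (hs : MeasurableSet s) (hfr : torusMeasure d (frontier s) = 0) (P : ℕ → Prop) [DecidablePred P]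
    (hP : ∀ n, 1 ≤ n → (P n ↔ n • α ∈ s)) :
    Tendsto (fun N : ℕ => (((Finset.Icc 1 N).filter P).card : ℝ) / N) atTop
      (𝓝 ((torusMeasure d).real s)) := by
  have hlim : Tendsto (empiricalMeasure fun n => (n + 1) • α) atTop
      (𝓝 (torusProbability d)) := by
    rw [ProbabilityMeasure.tendsto_iff_forall_integral_rclike_tendsto ℂ]
    intro f
    refine (tendsto_orbit_average hα f.toContinuousMap).congr fun N => ?_
    simp only [empiricalMeasure, ProbabilityMeasure.coe_mk]
    rw [integral_smul_measure, integral_finsetSum_measure]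
    · have : ((N : ENNReal) + 1).toReal = N + 1 := by
        rw [ENNReal.toReal_add (by simp) (by simp)]; simp
      simp [integral_dirac, this]
    · exact fun n _ => (integrable_dirac (by simp))
  have h := ProbabilityMeasure.tendsto_measure_of_null_frontier_of_tendsto' hlim hfr
  rw [← tendsto_add_atTop_iff_nat 1]
  have h' := (ENNReal.tendsto_toReal (measure_ne_top (torusMeasure d) s)).comp h
  refine h'.congr fun N => ?_
  classical
  have hcard : ((Finset.Icc 1 (N + 1)).filter P).card
      = ((Finset.range (N + 1)).filter fun n => (n + 1) • α ∈ s).card := by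
    symm
    refine Finset.card_bij (fun n _ => n + 1) ?_ ?_ ?_
    · intro n hn
      simp only [Finset.mem_filter, Finset.mem_range, Finset.mem_Icc] at hn ⊢
      exact ⟨⟨by omega, by omega⟩, (hP _ (by omega)).2 hn.2⟩
    · intro a _ b _ hab; omega
    · intro n hn
      simp only [Finset.mem_filter, Finset.mem_Icc] at hn
      refine ⟨n - 1, ?_, by omega⟩
      simp only [Finset.mem_filter, Finset.mem_range]
      have h1 : n - 1 + 1 = n := by omega
      rw [h1]
      exact ⟨by omega, (hP _ hn.1.1).1 hn.2⟩
  simp only [Function.comp, empiricalMeasure, ProbabilityMeasure.coe_mk, Measure.smul_apply,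
    Measure.finsetSum_apply, Measure.dirac_apply' _ hs, smul_eq_mul, Set.indicator_apply,
    Pi.one_apply, Finset.sum_boole]
  rw [hcard, ENNReal.toReal_mul, ENNReal.toReal_inv, div_eq_inv_mul]
  congr 1
  have : (N : ENNReal) + 1 = ((N + 1 : ℕ) : ENNReal) := by push_cast; rfl
  rw [this, ENNReal.toReal_natCast]

end Equidistribution

/-! ### The paradox in terms of levels -/

section Arithmetic

variable {m : ℕ} {p : Fin m → ℝ}

/-- An integer combination of independent sizes is an integer only if it is a multiple of the sum
of all sizes. -/
lemma IsIndependentSizes.eq_of_sum_eq_intCast (hp : IsIndependentSizes p) {g : Fin m → ℤ} {k : ℤ}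
    (h : ∑ l, (g l : ℝ) * p l = k) (l : Fin m) : g l = k := by
  -- Since the sizes sum to one, `k = ∑ k p_l`, which turns the hypothesis into a homogeneous
  -- relation.
  have h0 : ∑ l, ((g l - k : ℤ) : ℚ) • p l = 0 := by
    have : ∑ l, (k : ℝ) * p l = k := by rw [← Finset.mul_sum, hp.sum_eq_one, mul_one]
    simp only [Rat.smul_def, Int.cast_sub, Rat.cast_sub, Rat.cast_intCast, sub_mul,
      Finset.sum_sub_distrib, h, this, sub_self]
  have := Fintype.linearIndependent_iff.1 hp.linearIndependent _ h0 l
  have h1 : g l - k = 0 := by exact_mod_cast this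
  omega

/-- A tie would give an integer combination with coefficients `n` at `j` and `-n` at `i`, which are
not equal. Hence the priority list never matters. -/
lemma IsIndependentSizes.fract_ne (hp : IsIndependentSizes p) {n : ℕ} (hn : 1 ≤ n) {i j : Fin m}
    (hij : j ≠ i) : Int.fract (quota p n j) ≠ Int.fract (quota p n i) := by
  intro h
  obtain ⟨k, hk⟩ := Int.fract_eq_fract.1 h
  have h1 : ∑ l, (((if l = j then (n : ℤ) else 0) - (if l = i then (n : ℤ) else 0) : ℤ) : ℝ) * p l
      = k := by
    rw [← hk]
    simp [sub_mul, quota, Finset.sum_sub_distrib, ite_mul]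
  have h2 := hp.eq_of_sum_eq_intCast h1 j
  have h3 := hp.eq_of_sum_eq_intCast h1 i
  simp [hij, hij.symm] at h2 h3
  omega

lemma IsIndependentSizes.le_one (hp : IsIndependentSizes p) (i : Fin m) : p i ≤ 1 := by
  rw [← hp.sum_eq_one]
  exact Finset.single_le_sum (fun j _ => hp.nonneg j) (Finset.mem_univ i)

lemma IsIndependentSizes.pos (hp : IsIndependentSizes p) (i : Fin m) : 0 < p i :=
  lt_of_le_of_ne (hp.nonneg i) (hp.linearIndependent.ne_zero i).symm

/-- An integer-valued quantity that decides whether state `i` is rounded up. -/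
noncomputable def level (p : Fin m → ℝ) (n : ℕ) (i : Fin m) : ℝ :=
  m * Int.fract (n * p i) + ∑ j, Int.fract (n * (p j - p i))

/-- State `i` is rounded up exactly when its level is at least `m`. -/
lemma card_ahead_lt_remaining_iff (hp : IsIndependentSizes p) {n : ℕ} (hn : 1 ≤ n) (i : Fin m) :
    ((ahead p n i).card : ℤ) < remaining p n ↔ (m : ℝ) - 1 < level p n i := by
  classical
  have hrem : (remaining p n : ℝ) = ∑ j, Int.fract (quota p n j) := by
    have : (n : ℝ) = ∑ j, quota p n j := by
      simp only [quota, ← Finset.mul_sum, hp.sum_eq_one, mul_one]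
    simp only [remaining, Int.cast_sub, Int.cast_natCast, Int.cast_sum, Int.fract,
      Finset.sum_sub_distrib, ← this]
  have hcard : ((ahead p n i).card : ℝ) = ∑ j, if j ∈ ahead p n i then (1 : ℝ) else 0 := by
    simp
  -- The fractional part of a difference is the difference of fractional parts, plus one exactly
  -- when `j` is not ahead of `i`. The term `j = i` has no such correction, whence `m - 1` and not
  -- `m` after summation.
  have hpt : ∀ j, Int.fract (quota p n j) - (if j ∈ ahead p n i then (1 : ℝ) else 0)
      = Int.fract (n * p i) + Int.fract (n * (p j - p i)) - (1 - if j = i then 1 else 0) := by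
    intro j
    by_cases hj : j = i
    · subst hj
      have hmem : j ∉ ahead p n j := by
        rw [ahead, Finset.mem_filter]
        rintro ⟨-, h | h⟩
        · exact lt_irrefl _ h
        · exact lt_irrefl _ h.2
      rw [if_neg hmem]
      simp [quota]
    · have hne := hp.fract_ne hn hj
      have hmem : j ∈ ahead p n i ↔ Int.fract (n * p i) < Int.fract (n * p j) := by
        rw [ahead, Finset.mem_filter]
        exact ⟨fun h => h.2.resolve_right fun h' => hne h'.1, fun h => ⟨Finset.mem_univ j, Or.inl h⟩⟩
      rw [if_neg hj]
      simp only [quota, mul_sub] at hne ⊢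
      have h1 := Int.fract_nonneg (n * p j : ℝ)
      have h2 := Int.fract_nonneg (n * p i : ℝ)
      have h3 := Int.fract_lt_one (n * p j : ℝ)
      have h4 := Int.fract_lt_one (n * p i : ℝ)
      have h5 := Int.floor_add_fract (n * p j : ℝ)
      have h6 := Int.floor_add_fract (n * p i : ℝ)
      by_cases h : Int.fract (n * p i) < Int.fract (n * p j)
      · rw [if_pos (hmem.2 h)]
        have : Int.fract (n * p j - n * p i : ℝ) = Int.fract (n * p j) - Int.fract (n * p i) := by
          rw [Int.fract_eq_iff]
          refine ⟨by linarith, by linarith, ⌊(n * p j : ℝ)⌋ - ⌊(n * p i : ℝ)⌋, ?_⟩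
          push_cast; linarith
        rw [this]; ring
      · rw [if_neg (mt hmem.1 h)]
        have h' := lt_of_le_of_ne (not_lt.1 h) hne
        have : Int.fract (n * p j - n * p i : ℝ)
            = Int.fract (n * p j) - Int.fract (n * p i) + 1 := by
          rw [Int.fract_eq_iff]
          refine ⟨by linarith, by linarith, ⌊(n * p j : ℝ)⌋ - ⌊(n * p i : ℝ)⌋ - 1, ?_⟩
          push_cast; linarith
        rw [this]; ring
  have hsum : (remaining p n : ℝ) - (ahead p n i).card = level p n i - (m - 1) := by
    rw [hrem, hcard, ← Finset.sum_sub_distrib, Finset.sum_congr rfl fun j _ => hpt j, level]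
    simp only [Finset.sum_sub_distrib, Finset.sum_add_distrib, Finset.sum_const, Finset.card_univ,
      Fintype.card_fin, nsmul_eq_mul, Finset.sum_ite_eq', Finset.mem_univ, if_true]
    ring
  rw [← Int.cast_lt (R := ℝ), Int.cast_natCast]
  constructor <;> intro h <;> linarith

/-- Characterisation of the Alabama paradox through levels. -/
lemma suffers_iff_level (hp : IsIndependentSizes p) {n : ℕ} (hn : 1 ≤ n) (i : Fin m) :
    Suffers p n i ↔ (m : ℝ) - 1 < level p n i ∧
      m * (Int.fract (n * p i) + p i) + ∑ j, Int.fract (((n + 1 : ℕ) : ℝ) * (p j - p i))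
        ≤ m - 1 := by
  have hm : (0 : ℝ) < m := by exact_mod_cast i.pos
  have hS : 0 ≤ ∑ j, Int.fract (((n + 1 : ℕ) : ℝ) * (p j - p i)) :=
    Finset.sum_nonneg fun j _ => Int.fract_nonneg _
  have hf0 := Int.fract_nonneg (n * p i : ℝ)
  have hf1 := Int.fract_lt_one (n * p i : ℝ)
  have hff := Int.floor_add_fract (n * p i : ℝ)
  have hp0 := hp.nonneg i
  have hp1 := hp.le_one i
  have e1 : quota p n i = n * p i := rfl
  have e2 : quota p (n + 1) i = n * p i + p i := by simp only [quota]; push_cast; ring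
  have hup := card_ahead_lt_remaining_iff hp hn i
  have hup' := card_ahead_lt_remaining_iff hp (n := n + 1) (by omega) i
  have hsame : ⌊(n * p i + p i : ℝ)⌋ = ⌊(n * p i : ℝ)⌋ → level p (n + 1) i
      = m * (Int.fract (n * p i) + p i)
        + ∑ j, Int.fract (((n + 1 : ℕ) : ℝ) * (p j - p i)) := by
    intro h
    have h1 : ((n + 1 : ℕ) : ℝ) * p i = n * p i + p i := by push_cast; ring
    have h2 : Int.fract (((n + 1 : ℕ) : ℝ) * p i) = Int.fract (n * p i : ℝ) + p i := by
      rw [h1, Int.fract, h]; linarith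
    rw [level, h2]
  unfold Suffers seats
  rw [e1, e2]
  constructor
  · intro h
    -- Rounding costs at most one seat, so an increase of the floor would already rule out a loss.
    have hmono : ⌊(n * p i : ℝ)⌋ ≤ ⌊(n * p i + p i : ℝ)⌋ := Int.floor_mono (by linarith)
    have hfl : ⌊(n * p i + p i : ℝ)⌋ = ⌊(n * p i : ℝ)⌋ := by
      split_ifs at h <;> omega
    rw [hfl] at h
    have h1 : ((ahead p n i).card : ℤ) < remaining p n := by
      by_contra h'
      rw [if_neg h'] at h
      split_ifs at h <;> omega
    have h2 : ¬ ((ahead p (n + 1) i).card : ℤ) < remaining p (n + 1) := by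
      intro h'
      rw [if_pos h'] at h
      split_ifs at h; omega
    rw [hup', hsame hfl, not_lt] at h2
    exact ⟨hup.1 h1, h2⟩
  · rintro ⟨h1, h2⟩
    -- A wrap of the remainder of `i` would make the left side of `h2` at least `m`.
    have hlt : Int.fract (n * p i : ℝ) + p i < 1 := by
      by_contra h'
      have : (m : ℝ) * 1 ≤ m * (Int.fract (n * p i) + p i) :=
        mul_le_mul_of_nonneg_left (not_lt.1 h') hm.le
      linarith
    have hfl : ⌊(n * p i + p i : ℝ)⌋ = ⌊(n * p i : ℝ)⌋ := by
      rw [Int.floor_eq_iff]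
      constructor <;> linarith
    rw [← hsame hfl, ← not_lt, ← hup'] at h2
    rw [hfl, if_pos (hup.2 h1), if_neg h2]
    omega

end Arithmetic

/-! ### Fractional parts and crossings on the circle -/

section Circle

/-- The representative in `[0, 1)` of a point of the circle. -/
noncomputable def circleFract (x : UnitAddCircle) : ℝ := AddCircle.equivIco 1 0 x

lemma circleFract_nonneg (x : UnitAddCircle) : 0 ≤ circleFract x :=
  (AddCircle.equivIco 1 0 x).2.1

lemma circleFract_lt_one (x : UnitAddCircle) : circleFract x < 1 :=
  (AddCircle.equivIco 1 0 x).2.2.trans_eq (zero_add 1)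

@[simp]
lemma coe_circleFract (x : UnitAddCircle) : (circleFract x : UnitAddCircle) = x :=
  AddCircle.coe_equivIco

lemma circleFract_coe (t : ℝ) : circleFract (t : UnitAddCircle) = Int.fract t := by
  have := AddCircle.coe_equivIco_mk_apply (p := (1 : ℝ)) t
  rw [div_one, mul_one] at this
  exact this

lemma continuousAt_circleFract {x : UnitAddCircle} (hx : x ≠ 0) : ContinuousAt circleFract x :=
  continuousAt_subtype_val.comp (AddCircle.continuousAt_equivIco 1 0 (by simpa using hx))

lemma measurable_circleFract : Measurable circleFract :=
  measurable_subtype_coe.comp (AddCircle.measurableEquivIco 1 0).measurable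

lemma exists_intCast_eq_of_coe_eq_zero {t : ℝ} (h : (t : UnitAddCircle) = 0) :
    ∃ k : ℤ, t = k := by
  obtain ⟨k, hk⟩ := (AddCircle.coe_eq_zero_iff (1 : ℝ)).1 h
  exact ⟨k, by simpa using hk.symm⟩

/-- The signed number of times that a path of displacement `c` starting at `t` crosses zero. -/
noncomputable def crossing (c : ℝ) (t : UnitAddCircle) : ℝ :=
  circleFract t + c - circleFract (t + (c : UnitAddCircle))

lemma exists_intCast_eq_crossing (c : ℝ) (t : UnitAddCircle) : ∃ k : ℤ, crossing c t = k := by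
  apply exists_intCast_eq_of_coe_eq_zero
  simp [crossing]

lemma crossing_le_one {c : ℝ} (hc : c < 1) (t : UnitAddCircle) : crossing c t ≤ 1 := by
  obtain ⟨k, hk⟩ := exists_intCast_eq_crossing c t
  have h1 := circleFract_lt_one t
  have h2 := circleFract_nonneg (t + (c : UnitAddCircle))
  have h : crossing c t < 2 := by unfold crossing; linarith
  rw [hk] at h ⊢
  have : k < 2 := by exact_mod_cast h
  exact_mod_cast (by omega : k ≤ 1)

lemma crossing_nonneg {c : ℝ} (hc : 0 ≤ c) (t : UnitAddCircle) : 0 ≤ crossing c t := by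
  obtain ⟨k, hk⟩ := exists_intCast_eq_crossing c t
  have h1 := circleFract_nonneg t
  have h2 := circleFract_lt_one (t + (c : UnitAddCircle))
  have h : -1 < crossing c t := by unfold crossing; linarith
  rw [hk] at h ⊢
  have : -1 < k := by exact_mod_cast h
  exact_mod_cast (by omega : 0 ≤ k)

lemma crossing_nonpos {c : ℝ} (hc : c ≤ 0) (t : UnitAddCircle) : crossing c t ≤ 0 := by
  obtain ⟨k, hk⟩ := exists_intCast_eq_crossing c t
  have h1 := circleFract_lt_one t
  have h2 := circleFract_nonneg (t + (c : UnitAddCircle))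
  have h : crossing c t < 1 := by unfold crossing; linarith
  rw [hk] at h ⊢
  have : k < 1 := by exact_mod_cast h
  exact_mod_cast (by omega : k ≤ 0)

lemma measurable_crossing (c : ℝ) : Measurable (crossing c) :=
  (measurable_circleFract.add_const c).sub
    (measurable_circleFract.comp (measurable_id.add_const _))

lemma abs_crossing_le (c : ℝ) (t : UnitAddCircle) : |crossing c t| ≤ 1 + |c| := by
  have h1 := circleFract_lt_one t
  have h2 := circleFract_nonneg (t + (c : UnitAddCircle))
  have h3 := circleFract_nonneg t
  have h4 := circleFract_lt_one (t + (c : UnitAddCircle))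
  have h5 := neg_abs_le c
  have h6 := le_abs_self c
  rw [abs_le]; unfold crossing
  constructor <;> linarith

lemma continuousAt_crossing {c : ℝ} {t : UnitAddCircle} (h0 : t ≠ 0)
    (hc : t + (c : UnitAddCircle) ≠ 0) : ContinuousAt (crossing c) t := by
  refine ((continuousAt_circleFract h0).add continuousAt_const).sub ?_
  exact ContinuousAt.comp (g := circleFract) (continuousAt_circleFract hc)
    (continuousAt_id.add continuousAt_const)

lemma integrable_circleFract : Integrable circleFract AddCircle.haarAddCircle :=
  Integrable.of_bound measurable_circleFract.aestronglyMeasurable 1 <| Eventually.of_forall fun x =>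
    by rw [Real.norm_of_nonneg (circleFract_nonneg x)]; exact (circleFract_lt_one x).le

lemma integrable_crossing (c : ℝ) : Integrable (crossing c) AddCircle.haarAddCircle :=
  Integrable.of_bound (measurable_crossing c).aestronglyMeasurable (1 + |c|) <|
    Eventually.of_forall fun x => abs_crossing_le c x

/-- The two fractional parts have equal integrals by translation invariance, so only `c` is left. -/
lemma integral_crossing (c : ℝ) : ∫ t, crossing c t ∂AddCircle.haarAddCircle = c := by
  have h : ∫ t, circleFract (t + (c : UnitAddCircle)) ∂AddCircle.haarAddCircle
      = ∫ t, circleFract t ∂AddCircle.haarAddCircle :=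
    integral_add_right_eq_self circleFract _
  have hi : Integrable (fun t : UnitAddCircle => circleFract (t + (c : UnitAddCircle)))
      AddCircle.haarAddCircle := integrable_circleFract.comp_add_right _
  have hs : Integrable (fun t => circleFract t + c) AddCircle.haarAddCircle :=
    integrable_circleFract.add (integrable_const c)
  unfold crossing
  rw [integral_sub hs hi, integral_add integrable_circleFract (integrable_const c), h]
  simp

/-- A crossing never has the sign opposite to `c`, so its positive part is either itself or zero. -/
lemma integral_max_crossing (c : ℝ) :
    ∫ t, max (crossing c t) 0 ∂AddCircle.haarAddCircle = max c 0 := by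
  rcases le_total 0 c with hc | hc
  · simp_rw [max_eq_left (crossing_nonneg hc _), integral_crossing, max_eq_left hc]
  · simp_rw [max_eq_right (crossing_nonpos hc _), max_eq_right hc]
    simp

end Circle

/-! ### The paradox as a subset of the torus -/

section Torus

lemma haarAddCircle_singleton (a : UnitAddCircle) :
    (AddCircle.haarAddCircle : Measure UnitAddCircle) {a} = 0 := by
  have h := AddCircle.volume_closedBall (T := (1 : ℝ)) (x := a) 0
  rw [Metric.closedBall_zero, AddCircle.volume_eq_smul_haarAddCircle] at h
  simpa using h

variable {d : Type*} [Fintype d]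

/-- The coordinate of the reference state, recovered from the others: all coordinates of a vector
of remainders add up to zero on the circle. -/
noncomputable def baseCoord (d : Type*) [Fintype d] : UnitAddTorus d →+ UnitAddCircle where
  toFun x := -∑ j, x j
  map_zero' := by simp
  map_add' x y := by simp [Finset.sum_add_distrib]; abel

/-- Coordinates relative to the reference state. -/
noncomputable def relCoords (d : Type*) [Fintype d] : UnitAddTorus d →+ UnitAddTorus d where
  toFun x j := x j - baseCoord d x
  map_zero' := by ext; simp
  map_add' x y := by ext; simp; abel

lemma baseCoord_apply (x : UnitAddTorus d) : baseCoord d x = -∑ j, x j := rfl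

lemma relCoords_apply (x : UnitAddTorus d) (j : d) :
    relCoords d x j = x j - baseCoord d x := rfl

lemma continuous_baseCoord : Continuous (baseCoord d) := by
  change Continuous fun x : UnitAddTorus d => -∑ j, x j
  fun_prop

lemma continuous_relCoords : Continuous (relCoords d) :=
  continuous_pi fun j => (continuous_apply j).sub continuous_baseCoord

lemma surjective_baseCoord [Nonempty d] : Function.Surjective (baseCoord d) := by
  classical
  intro y
  obtain ⟨j⟩ := ‹Nonempty d›
  exact ⟨Pi.single j (-y), by simp [baseCoord_apply]⟩

lemma surjective_relCoords : Function.Surjective (relCoords d) := by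
  intro z
  -- If `x = z - t` on the diagonal has base coordinate `-t`, then `(|d| + 1) t = ∑ z_j`; dividing a
  -- real representative solves this.
  set t : ℝ := circleFract (∑ j, z j) / (Fintype.card d + 1) with ht
  have hpos : (0 : ℝ) < Fintype.card d + 1 := by positivity
  have h1 : (Fintype.card d + 1) • (t : UnitAddCircle) = ∑ j, z j := by
    rw [← AddCircle.coe_nsmul, nsmul_eq_mul, ht]
    push_cast
    rw [mul_div_cancel₀ _ hpos.ne', coe_circleFract]
  refine ⟨fun j => z j - (t : UnitAddCircle), ?_⟩
  have hb : baseCoord d (fun j => z j - (t : UnitAddCircle)) = -(t : UnitAddCircle) := by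
    rw [baseCoord_apply, Finset.sum_sub_distrib, ← h1, succ_nsmul]
    simp
  ext j
  rw [relCoords_apply, hb]
  abel

/-- A continuous surjective homomorphism of compact groups carries Haar probability to Haar
probability. Thus the differences are again independent and uniform. -/
lemma measurePreserving_relCoords :
    MeasurePreserving (relCoords d) (torusMeasure d) (torusMeasure d) :=
  AddMonoidHom.measurePreserving continuous_relCoords surjective_relCoords rfl

lemma measure_preimage_singleton_eq_zero {f : UnitAddTorus d →+ UnitAddCircle}
    (hf : Continuous f) (hs : Function.Surjective f) (a : UnitAddCircle) :
    torusMeasure d (f ⁻¹' {a}) = 0 := by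
  have h : MeasurePreserving f (torusMeasure d) AddCircle.haarAddCircle :=
    AddMonoidHom.measurePreserving hf hs (by simp)
  rw [h.measure_preimage (measurableSet_singleton a).nullMeasurableSet, haarAddCircle_singleton]

lemma measure_relCoords_eq_zero (j : d) (a : UnitAddCircle) :
    torusMeasure d {x | relCoords d x j = a} = 0 :=
  measure_preimage_singleton_eq_zero (f := (Pi.evalAddMonoidHom _ j).comp (relCoords d))
    ((continuous_apply j).comp continuous_relCoords)
    (fun y => by
      obtain ⟨x, hx⟩ := surjective_relCoords (d := d) (fun _ => y)
      exact ⟨x, by simp [hx]⟩) a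

/-- The level of the reference state, as a function on the torus. -/
noncomputable def torusLevel (x : UnitAddTorus d) : ℝ :=
  (Fintype.card d + 1) * circleFract (baseCoord d x) + ∑ j, circleFract (relCoords d x j)

/-- The net number of crossings of the reference state by the other states. -/
noncomputable def netCrossing (c : d → ℝ) (z : UnitAddTorus d) : ℝ := ∑ j, crossing (c j) (z j)

/-- Modulo one, with `b` the base coordinate, the level is `(|d| + 1) b + ∑ (x_j - b) = b + ∑ x_j =
0`. -/
lemma exists_intCast_eq_torusLevel (x : UnitAddTorus d) : ∃ k : ℤ, torusLevel x = k := by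
  apply exists_intCast_eq_of_coe_eq_zero
  have h1 : (((Fintype.card d + 1 : ℝ) * circleFract (baseCoord d x) : ℝ) : UnitAddCircle)
      = (Fintype.card d + 1) • baseCoord d x := by
    conv_rhs => rw [← coe_circleFract (baseCoord d x)]
    rw [← AddCircle.coe_nsmul, nsmul_eq_mul]
    push_cast; rfl
  have h2 : ((∑ j, circleFract (relCoords d x j) : ℝ) : UnitAddCircle) = ∑ j, relCoords d x j := by
    have := map_sum (QuotientAddGroup.mk' (AddSubgroup.zmultiples (1 : ℝ)))
      (fun j => circleFract (relCoords d x j)) Finset.univ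
    refine this.trans (Finset.sum_congr rfl fun j _ => coe_circleFract _)
  rw [torusLevel, AddCircle.coe_add, h1, h2]
  simp only [relCoords_apply, Finset.sum_sub_distrib, Finset.sum_const, Finset.card_univ,
    succ_nsmul]
  rw [baseCoord_apply]
  abel

lemma exists_intCast_eq_netCrossing (c : d → ℝ) (z : UnitAddTorus d) :
    ∃ k : ℤ, netCrossing c z = k := by
  choose k hk using fun j => exists_intCast_eq_crossing (c j) (z j)
  exact ⟨∑ j, k j, by simp [netCrossing, hk]⟩

lemma netCrossing_le {c : d → ℝ} (hc : ∀ j, c j < 1) (z : UnitAddTorus d) :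
    netCrossing c z ≤ Fintype.card d := by
  refine (Finset.sum_le_sum fun j _ => crossing_le_one (hc j) (z j)).trans ?_
  simp

lemma torusLevel_nonneg (x : UnitAddTorus d) : 0 ≤ torusLevel x :=
  add_nonneg (mul_nonneg (by positivity) (circleFract_nonneg _))
    (Finset.sum_nonneg fun j _ => circleFract_nonneg _)

lemma torusLevel_lt (x : UnitAddTorus d) : torusLevel x < 2 * (Fintype.card d + 1) := by
  have h1 := circleFract_lt_one (baseCoord d x)
  have hpos : (0 : ℝ) < Fintype.card d + 1 := by positivity
  have h2 : ∑ j, circleFract (relCoords d x j) ≤ Fintype.card d := by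
    refine (Finset.sum_le_sum fun j _ => (circleFract_lt_one (relCoords d x j)).le).trans ?_
    simp
  have h3 := mul_lt_mul_of_pos_left h1 hpos
  unfold torusLevel
  linarith

lemma netCrossing_le_torusLevel_add_one {c : d → ℝ} (hc : ∑ j, c j ≤ 1) (x : UnitAddTorus d) :
    netCrossing c (relCoords d x) ≤ torusLevel x + 1 := by
  have h1 : 0 ≤ ((Fintype.card d : ℝ) + 1) * circleFract (baseCoord d x) :=
    mul_nonneg (by positivity) (circleFract_nonneg _)
  have h2 : 0 ≤ ∑ j, circleFract (relCoords d x j + (c j : UnitAddCircle)) :=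
    Finset.sum_nonneg fun j _ => circleFract_nonneg _
  simp only [netCrossing, crossing, torusLevel, Finset.sum_sub_distrib, Finset.sum_add_distrib]
  linarith

/-- The set of positions on the torus for which the reference state suffers. -/
def paradoxSet (c : d → ℝ) : Set (UnitAddTorus d) :=
  {x | (Fintype.card d : ℝ) < torusLevel x ∧
    torusLevel x + 1 - netCrossing c (relCoords d x) ≤ Fintype.card d}

/-- Membership depends on the level only modulo `|d| + 1`, so translates can be counted by residues.
For `k ≤ |d|` both sides fail because `w ≤ k + 1`; otherwise `k < 2(|d| + 1)` and the residue is `k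
- (|d| + 1)`. -/
lemma mem_paradoxSet_iff {c : d → ℝ} (hc : ∑ j, c j ≤ 1) {x : UnitAddTorus d} {k w : ℤ}
    (hk : torusLevel x = k) (hw : netCrossing c (relCoords d x) = w) :
    x ∈ paradoxSet c ↔ k % (Fintype.card d + 1 : ℕ) + 2 ≤ w := by
  have h0 := torusLevel_nonneg x
  have h1 := torusLevel_lt x
  have h2 := netCrossing_le_torusLevel_add_one hc x
  rw [hk] at h0 h1 h2
  rw [hw] at h2
  have e0 : 0 ≤ k := by exact_mod_cast h0
  have e1 : k < 2 * (Fintype.card d + 1) := by exact_mod_cast h1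
  have e2 : w ≤ k + 1 := by exact_mod_cast h2
  have e3 : x ∈ paradoxSet c ↔ (Fintype.card d : ℤ) < k ∧ k + 1 - w ≤ Fintype.card d := by
    rw [paradoxSet, Set.mem_ofPred_eq, hk, hw]
    norm_cast
  rw [e3]
  push_cast
  have e4 : k < Fintype.card d + 1 → k % (Fintype.card d + 1 : ℤ) = k :=
    fun h => Int.emod_eq_of_lt e0 h
  have e5 : (Fintype.card d : ℤ) + 1 ≤ k →
      k % (Fintype.card d + 1 : ℤ) = k - (Fintype.card d + 1) := fun h => by
    rw [← Int.sub_emod_right]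
    exact Int.emod_eq_of_lt (by omega) (by omega)
  rcases lt_or_ge k (Fintype.card d + 1) with h | h
  · rw [e4 h]; omega
  · rw [e5 h]; omega

lemma measurable_torusLevel : Measurable (torusLevel (d := d)) := by
  refine ((measurable_circleFract.comp continuous_baseCoord.measurable).const_mul _).add ?_
  exact Finset.measurable_fun_sum _ fun j _ => measurable_circleFract.comp
    ((measurable_pi_apply j).comp continuous_relCoords.measurable)

lemma measurable_netCrossing (c : d → ℝ) : Measurable (netCrossing c) :=
  Finset.measurable_fun_sum _ fun j _ => (measurable_crossing (c j)).comp (measurable_pi_apply j)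

lemma measurableSet_paradoxSet (c : d → ℝ) : MeasurableSet (paradoxSet c) := by
  refine (measurableSet_lt measurable_const measurable_torusLevel).inter ?_
  exact measurableSet_le ((measurable_torusLevel.add_const 1).sub
    ((measurable_netCrossing c).comp continuous_relCoords.measurable)) measurable_const

/-- Away from the discontinuities of the fractional parts, `paradoxSet` has no boundary. -/
lemma not_mem_frontier_paradoxSet {c : d → ℝ} {x : UnitAddTorus d} (h0 : baseCoord d x ≠ 0)
    (h1 : ∀ j, relCoords d x j ≠ 0) (h2 : ∀ j, relCoords d x j + (c j : UnitAddCircle) ≠ 0) :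
    x ∉ frontier (paradoxSet c) := by
  have hrel : ∀ j, ContinuousAt (fun x => relCoords d x j) x := fun j =>
    ((continuous_apply j).comp continuous_relCoords).continuousAt
  have hL : ContinuousAt torusLevel x := by
    refine ContinuousAt.add (continuousAt_const.mul ?_) (tendsto_finsetSum _ fun j _ => ?_)
    · exact ContinuousAt.comp (g := circleFract) (continuousAt_circleFract h0)
        continuous_baseCoord.continuousAt
    · exact ContinuousAt.comp (g := circleFract) (continuousAt_circleFract (h1 j)) (hrel j)
  have hW : ContinuousAt (fun x => netCrossing c (relCoords d x)) x :=
    tendsto_finsetSum _ fun j _ =>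
      ContinuousAt.comp (g := crossing (c j)) (continuousAt_crossing (h1 j) (h2 j)) (hrel j)
  have hev : ∀ᶠ y in 𝓝 x, torusLevel y = torusLevel x ∧
      netCrossing c (relCoords d y) = netCrossing c (relCoords d x) := by
    -- An integer-valued function is constant near each point of continuity.
    have key : ∀ f : UnitAddTorus d → ℝ, (∀ y, ∃ k : ℤ, f y = k) → ContinuousAt f x →
        ∀ᶠ y in 𝓝 x, f y = f x := by
      intro f hf hc
      filter_upwards [Metric.tendsto_nhds.1 hc 1 one_pos] with y hy
      obtain ⟨k, hk⟩ := hf y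
      obtain ⟨l, hl⟩ := hf x
      rw [hk, hl, Real.dist_eq] at hy
      rw [hk, hl]
      have : |k - l| < 1 := by exact_mod_cast hy
      rw [Int.abs_lt_one_iff] at this
      rw [sub_eq_zero.1 this]
    exact (key _ exists_intCast_eq_torusLevel hL).and
      (key _ (fun y => exists_intCast_eq_netCrossing c _) hW)
  have hiff : ∀ᶠ y in 𝓝 x, (y ∈ paradoxSet c ↔ x ∈ paradoxSet c) := by
    filter_upwards [hev] with y hy
    simp only [paradoxSet, Set.mem_ofPred_eq, hy.1, hy.2]
  rw [frontier_eq_closure_inter_closure]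
  rintro ⟨ha, hb⟩
  rw [mem_closure_iff_frequently] at ha hb
  obtain ⟨y, hy, hy'⟩ := (ha.and_eventually hiff).exists
  obtain ⟨z, hz, hz'⟩ := (hb.and_eventually hiff).exists
  exact hz (hz'.2 (hy'.1 hy))

lemma measure_frontier_paradoxSet (c : d → ℝ) : torusMeasure d (frontier (paradoxSet c)) = 0 := by
  cases isEmpty_or_nonempty d with
  -- On the one-point torus `baseCoord` is not surjective, so its zero set need not be null.
  | inl h =>
    have : IsClopen (paradoxSet c) :=
      Subsingleton.set_cases (p := fun s : Set (UnitAddTorus d) => IsClopen s)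
        isClopen_empty isClopen_univ (paradoxSet c)
    rw [this.frontier_eq, measure_empty]
  | inr h =>
    refine measure_mono_null (t := {x | baseCoord d x = 0} ∪ ((⋃ j, {x | relCoords d x j = 0}) ∪
      ⋃ j, {x | relCoords d x j = -(c j : UnitAddCircle)})) ?_ ?_
    · intro x hx
      by_contra hcon
      simp only [Set.mem_union, Set.mem_ofPred_eq, Set.mem_iUnion, not_or, not_exists] at hcon
      exact not_mem_frontier_paradoxSet hcon.1 hcon.2.1
        (fun j h => hcon.2.2 j (eq_neg_of_add_eq_zero_left h)) hx
    · refine measure_union_null ?_ (measure_union_null ?_ ?_)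
      · exact measure_preimage_singleton_eq_zero continuous_baseCoord surjective_baseCoord 0
      · exact measure_iUnion_null fun j => measure_relCoords_eq_zero j 0
      · exact measure_iUnion_null fun j => measure_relCoords_eq_zero j _

end Torus

/-! ### Averaging over diagonal translations, and the mean of `(W - 1)⁺` -/

section Excess

/-- A full period meets each residue once, and the admissible residues are `0, …, w - 2`; `w ≤ M`
ensures that none is cut off. -/
lemma card_filter_emod_add_two_le {M : ℕ} {k w : ℤ} (hk : 0 ≤ k) (hw : w ≤ M) :
    ((Finset.range M).filter fun s : ℕ => (k + s) % (M : ℤ) + 2 ≤ w).card = (w - 1).toNat := by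
  lift k to ℕ using hk
  have hper : Function.Periodic (fun t : ℕ => ((t : ℤ) % (M : ℤ) + 2 ≤ w)) M := fun t => by
    simp only [Nat.cast_add, Int.add_emod_right]
  have h1 := Nat.filter_Ico_card_eq_of_periodic k M _ hper
  rw [Nat.count_eq_card_filter_range] at h1
  have h2 : ((Finset.range M).filter fun s : ℕ => ((k : ℤ) + s) % (M : ℤ) + 2 ≤ w).card
      = ((Finset.Ico k (k + M)).filter fun t : ℕ => (t : ℤ) % (M : ℤ) + 2 ≤ w).card := by
    refine Finset.card_bij (fun s _ => k + s) ?_ ?_ ?_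
    · intro s hs
      simp only [Finset.mem_filter, Finset.mem_range, Finset.mem_Ico] at hs ⊢
      refine ⟨⟨by omega, by omega⟩, ?_⟩
      push_cast; exact hs.2
    · intro a _ b _ hab; omega
    · intro t ht
      simp only [Finset.mem_filter, Finset.mem_Ico] at ht
      refine ⟨t - k, ?_, by omega⟩
      simp only [Finset.mem_filter, Finset.mem_range]
      refine ⟨by omega, ?_⟩
      rw [Nat.cast_sub ht.1.1, add_sub_cancel]
      exact ht.2
  rw [h2, h1]
  have h3 : ((Finset.range M).filter fun t : ℕ => (t : ℤ) % (M : ℤ) + 2 ≤ w)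
      = Finset.range (w - 1).toNat := by
    ext t
    simp only [Finset.mem_filter, Finset.mem_range]
    constructor
    · rintro ⟨h, h'⟩
      rw [Int.emod_eq_of_lt (by omega) (by omega)] at h'
      omega
    · intro h
      have : t < M := by omega
      rw [Int.emod_eq_of_lt (by omega) (by omega)]
      omega
  rw [h3, Finset.card_range]

variable {d : Type*} [Fintype d]

/-- The diagonal translation by `s / (|d| + 1)`. -/
noncomputable def diagShift (d : Type*) [Fintype d] (s : ℕ) : UnitAddTorus d :=
  fun _ => ((s / (Fintype.card d + 1) : ℝ) : UnitAddCircle)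

/-- Since `-|d| s / (|d| + 1)` and `s / (|d| + 1)` differ by the integer `s`, the base coordinate
moves along with all the others. -/
lemma baseCoord_diagShift (s : ℕ) :
    baseCoord d (diagShift d s) = ((s / (Fintype.card d + 1) : ℝ) : UnitAddCircle) := by
  have hpos : (0 : ℝ) < Fintype.card d + 1 := by positivity
  have h : (Fintype.card d + 1) • ((s / (Fintype.card d + 1) : ℝ) : UnitAddCircle) = 0 := by
    rw [← AddCircle.coe_nsmul, nsmul_eq_mul]
    push_cast
    rw [mul_div_cancel₀ _ hpos.ne', AddCircle.coe_eq_zero_iff]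
    exact ⟨s, by simp⟩
  rw [succ_nsmul, add_comm] at h
  rw [baseCoord_apply]
  simp only [diagShift, Finset.sum_const, Finset.card_univ]
  exact (eq_neg_of_add_eq_zero_left h).symm

lemma relCoords_diagShift (s : ℕ) : relCoords d (diagShift d s) = 0 := by
  ext j
  rw [relCoords_apply, baseCoord_diagShift]
  simp [diagShift]

/-- Only the base term moves; each wrap of its fractional part contributes a multiple of `|d| + 1`.
-/
lemma exists_torusLevel_add_diagShift (x : UnitAddTorus d) (s : ℕ) :
    ∃ k : ℤ, torusLevel (x + diagShift d s)
      = torusLevel x + s + k * (Fintype.card d + 1) := by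
  have hpos : (0 : ℝ) < Fintype.card d + 1 := by positivity
  obtain ⟨k, hk⟩ := exists_intCast_eq_of_coe_eq_zero
    (t := circleFract (baseCoord d (x + diagShift d s)) - circleFract (baseCoord d x)
      - s / (Fintype.card d + 1)) (by
      rw [AddCircle.coe_sub, AddCircle.coe_sub, coe_circleFract, coe_circleFract, map_add,
        baseCoord_diagShift]
      abel)
  refine ⟨k, ?_⟩
  have h1 : circleFract (baseCoord d (x + diagShift d s))
      = circleFract (baseCoord d x) + s / (Fintype.card d + 1) + k := by linarith
  rw [torusLevel, torusLevel, h1, map_add, relCoords_diagShift, add_zero]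
  field_simp
  ring

/-- Averaging over the diagonal translations. -/
lemma sum_indicator_paradoxSet {c : d → ℝ} (hc : ∑ j, c j ≤ 1) (hc1 : ∀ j, c j < 1)
    (x : UnitAddTorus d) :
    ∑ s ∈ Finset.range (Fintype.card d + 1),
      (paradoxSet c).indicator (fun _ => (1 : ℝ)) (x + diagShift d s)
      = max (netCrossing c (relCoords d x) - 1) 0 := by
  classical
  obtain ⟨k, hk⟩ := exists_intCast_eq_torusLevel x
  obtain ⟨w, hw⟩ := exists_intCast_eq_netCrossing c (relCoords d x)
  have hk0 : 0 ≤ k := by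
    have := torusLevel_nonneg x
    rw [hk] at this; exact_mod_cast this
  have hwM : w ≤ (Fintype.card d + 1 : ℕ) := by
    have := netCrossing_le hc1 (relCoords d x)
    rw [hw] at this
    have : w ≤ (Fintype.card d : ℤ) := by exact_mod_cast this
    push_cast; omega
  have hmem : ∀ s : ℕ, x + diagShift d s ∈ paradoxSet c ↔
      (k + s) % ((Fintype.card d + 1 : ℕ) : ℤ) + 2 ≤ w := by
    intro s
    obtain ⟨l, hl⟩ := exists_torusLevel_add_diagShift x s
    have h1 : torusLevel (x + diagShift d s)
        = ((k + s + l * (Fintype.card d + 1 : ℕ) : ℤ) : ℝ) := by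
      rw [hl, hk]; push_cast; ring
    have h2 : netCrossing c (relCoords d (x + diagShift d s)) = w := by
      rw [map_add, relCoords_diagShift, add_zero, hw]
    rw [mem_paradoxSet_iff hc h1 h2, Int.add_mul_emod_self_right]
  simp only [Set.indicator_apply, hmem]
  rw [Finset.sum_boole, card_filter_emod_add_two_le hk0 hwM, hw]
  rcases le_total w 1 with h | h
  · have h' : (w : ℝ) ≤ 1 := by exact_mod_cast h
    rw [Int.toNat_eq_zero.2 (by omega), max_eq_right (by linarith)]
    simp
  · have h' : (1 : ℝ) ≤ w := by exact_mod_cast h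
    rw [max_eq_left (by linarith), ← Int.cast_natCast, Int.toNat_of_nonneg (by omega)]
    push_cast; ring

/-- The expectation of the positive part of the net number of crossings minus one. -/
noncomputable def excess (c : d → ℝ) : ℝ :=
  ∫ z, max (netCrossing c z - 1) 0 ∂(torusMeasure d)

/-- The `|d| + 1` translated indicators have equal integrals and add up to `(W - 1)⁺`, a function of
the uniformly distributed `relCoords`. -/
lemma measureReal_paradoxSet {c : d → ℝ} (hc : ∑ j, c j ≤ 1) (hc1 : ∀ j, c j < 1) :
    (torusMeasure d).real (paradoxSet c) = excess c / (Fintype.card d + 1) := by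
  have hpos : (0 : ℝ) < Fintype.card d + 1 := by positivity
  have hms := measurableSet_paradoxSet c
  have hint : Integrable ((paradoxSet c).indicator fun _ => (1 : ℝ)) (torusMeasure d) :=
    (integrable_const 1).indicator hms
  have hg : AEStronglyMeasurable (fun z => max (netCrossing c z - 1) 0) (torusMeasure d) :=
    (((measurable_netCrossing c).sub_const 1).max measurable_const).aestronglyMeasurable
  have h1 : excess c = ∫ x, max (netCrossing c (relCoords d x) - 1) 0 ∂(torusMeasure d) := by
    have hmp := measurePreserving_relCoords (d := d)
    rw [excess]
    conv_lhs => rw [← hmp.map_eq]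
    rw [integral_map hmp.measurable.aemeasurable (by rw [hmp.map_eq]; exact hg)]
  have h2 : ∀ s, ∫ x, (paradoxSet c).indicator (fun _ => (1 : ℝ)) (x + diagShift d s)
      ∂(torusMeasure d) = (torusMeasure d).real (paradoxSet c) := fun s => by
    rw [integral_add_right_eq_self ((paradoxSet c).indicator fun _ => (1 : ℝ)) (diagShift d s),
      integral_indicator_const _ hms]
    simp
  simp_rw [h1, ← sum_indicator_paradoxSet hc hc1]
  rw [integral_finsetSum _ fun s _ => hint.comp_add_right (diagShift d s)]
  simp only [h2, Finset.sum_const, Finset.card_range, nsmul_eq_mul]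
  push_cast
  field_simp

lemma excess_nonneg (c : d → ℝ) : 0 ≤ excess c :=
  integral_nonneg fun _ => le_max_right _ _

lemma integrable_comp_eval {f : UnitAddCircle → ℝ} (hf : Integrable f AddCircle.haarAddCircle)
    (j : d) : Integrable (fun z : UnitAddTorus d => f (z j)) (torusMeasure d) :=
  (measurePreserving_eval (fun _ : d => AddCircle.haarAddCircle) j).integrable_comp_of_integrable hf

lemma integral_torus_comp_eval {f : UnitAddCircle → ℝ}
    (hf : Integrable f AddCircle.haarAddCircle) (j : d) :
    ∫ z : UnitAddTorus d, f (z j) ∂(torusMeasure d) = ∫ t, f t ∂AddCircle.haarAddCircle :=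
  integral_comp_eval hf.aestronglyMeasurable

lemma integrable_max_crossing (c : ℝ) :
    Integrable (fun t => max (crossing c t) 0) AddCircle.haarAddCircle :=
  (integrable_crossing c).sup (integrable_const 0)

lemma max_crossing_eq_zero_or_one {c : ℝ} (hc : c < 1) (t : UnitAddCircle) :
    max (crossing c t) 0 = 0 ∨ max (crossing c t) 0 = 1 := by
  obtain ⟨k, hk⟩ := exists_intCast_eq_crossing c t
  have h := crossing_le_one hc t
  rw [hk] at h ⊢
  have h' : k ≤ 1 := by exact_mod_cast h
  rcases h'.lt_or_eq with h1 | rfl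
  · left
    have : k ≤ 0 := by omega
    exact max_eq_right (by exact_mod_cast this)
  · right; simp

lemma integrable_prod_max_crossing {c : d → ℝ} :
    Integrable (fun z : UnitAddTorus d => ∏ j, (1 - max (crossing (c j) (z j)) 0))
      (torusMeasure d) :=
  Integrable.fintype_prod (f := fun j t => 1 - max (crossing (c j) t) 0)
    fun j => (integrable_const 1).sub (integrable_max_crossing (c j))

lemma integral_sum_max_crossing (c : d → ℝ) :
    ∫ z : UnitAddTorus d, ∑ j, max (crossing (c j) (z j)) 0 ∂(torusMeasure d)
      = ∑ j, max (c j) 0 := by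
  rw [integral_finsetSum _ fun j _ => integrable_comp_eval (integrable_max_crossing (c j)) j]
  exact Finset.sum_congr rfl fun j _ => by
    rw [integral_torus_comp_eval (integrable_max_crossing (c j)), integral_max_crossing]

lemma integral_netCrossing (c : d → ℝ) :
    ∫ z : UnitAddTorus d, netCrossing c z ∂(torusMeasure d) = ∑ j, c j := by
  unfold netCrossing
  rw [integral_finsetSum _ fun j _ => integrable_comp_eval (integrable_crossing (c j)) j]
  exact Finset.sum_congr rfl fun j _ => by
    rw [integral_torus_comp_eval (integrable_crossing (c j)), integral_crossing]

lemma integral_prod_max_crossing (c : d → ℝ) :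
    ∫ z : UnitAddTorus d, ∏ j, (1 - max (crossing (c j) (z j)) 0) ∂(torusMeasure d)
      = ∏ j, (1 - max (c j) 0) := by
  rw [integral_fintype_prod_eq_prod (f := fun j t => 1 - max (crossing (c j) t) 0)]
  refine Finset.prod_congr rfl fun j _ => ?_
  rw [integral_sub (integrable_const 1) (integrable_max_crossing (c j)), integral_max_crossing]
  simp

/-- The positive part of a sum of zeros and ones, minus one. -/
lemma max_sum_sub_one_eq {b : d → ℝ} (hb : ∀ j, b j = 0 ∨ b j = 1) :
    max (∑ j, b j - 1) 0 = ∑ j, b j - 1 + ∏ j, (1 - b j) := by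
  have hb0 : ∀ j, 0 ≤ b j := fun j => by rcases hb j with h | h <;> simp [h]
  by_cases h : ∃ j, b j = 1
  · obtain ⟨j, hj⟩ := h
    rw [Finset.prod_eq_zero (Finset.mem_univ j) (by rw [hj, sub_self]), add_zero, max_eq_left]
    have := Finset.single_le_sum (fun l _ => hb0 l) (Finset.mem_univ j)
    linarith
  · have h0 : ∀ j, b j = 0 := fun j => (hb j).resolve_right fun h1 => h ⟨j, h1⟩
    simp [h0]

lemma integrable_netCrossing (c : d → ℝ) : Integrable (netCrossing c) (torusMeasure d) :=
  integrable_finsetSum _ fun j _ => integrable_comp_eval (integrable_crossing (c j)) j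

lemma integrable_sum_max_crossing (c : d → ℝ) :
    Integrable (fun z : UnitAddTorus d => ∑ j, max (crossing (c j) (z j)) 0) (torusMeasure d) :=
  integrable_finsetSum _ fun j _ => integrable_comp_eval (integrable_max_crossing (c j)) j

/-- Dropping the negative crossings bounds `W` by a sum of independent Bernoulli variables, for
which `max_sum_sub_one_eq` is exact. -/
lemma excess_le {c : d → ℝ} (hc1 : ∀ j, c j < 1) :
    excess c ≤ ∑ j, max (c j) 0 - 1 + ∏ j, (1 - max (c j) 0) := by
  have hs : Integrable (fun z : UnitAddTorus d => ∑ j, max (crossing (c j) (z j)) 0 - 1)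
      (torusMeasure d) := (integrable_sum_max_crossing c).sub (integrable_const 1)
  have h1 : ∫ z : UnitAddTorus d, (∑ j, max (crossing (c j) (z j)) 0 - 1
      + ∏ j, (1 - max (crossing (c j) (z j)) 0)) ∂(torusMeasure d)
      = ∑ j, max (c j) 0 - 1 + ∏ j, (1 - max (c j) 0) := by
    rw [integral_add hs integrable_prod_max_crossing,
      integral_sub (integrable_sum_max_crossing c) (integrable_const 1),
      integral_sum_max_crossing, integral_prod_max_crossing]
    simp
  rw [← h1, excess]
  refine integral_mono (((integrable_netCrossing c).sub (integrable_const 1)).sup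
    (integrable_const 0)) (hs.add integrable_prod_max_crossing) fun z => ?_
  refine le_trans ?_ (max_sum_sub_one_eq fun j => max_crossing_eq_zero_or_one (hc1 j) (z j)).le
  refine max_le_max (sub_le_sub_right ?_ _) le_rfl
  exact Finset.sum_le_sum fun j _ => le_max_left _ _

/-- Negative crossings stay in the linear term, while the product indicates that no positive
crossing occurs. If one occurs the product vanishes; if none does, `W ≤ 0` and the left integrand is
at most zero. -/
lemma le_excess {c : d → ℝ} (hc1 : ∀ j, c j < 1) :
    ∑ j, c j - 1 + ∏ j, (1 - max (c j) 0) ≤ excess c := by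
  have hs : Integrable (fun z : UnitAddTorus d => netCrossing c z - 1) (torusMeasure d) :=
    (integrable_netCrossing c).sub (integrable_const 1)
  have h1 : ∫ z : UnitAddTorus d, (netCrossing c z - 1
      + ∏ j, (1 - max (crossing (c j) (z j)) 0)) ∂(torusMeasure d)
      = ∑ j, c j - 1 + ∏ j, (1 - max (c j) 0) := by
    rw [integral_add hs integrable_prod_max_crossing,
      integral_sub (integrable_netCrossing c) (integrable_const 1),
      integral_netCrossing, integral_prod_max_crossing]
    simp
  rw [← h1, excess]
  refine integral_mono (hs.add integrable_prod_max_crossing)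
    (((integrable_netCrossing c).sub (integrable_const 1)).sup (integrable_const 0)) fun z => ?_
  have h2 := max_sum_sub_one_eq fun j => max_crossing_eq_zero_or_one (hc1 j) (z j)
  have h3 : netCrossing c z ≤ ∑ j, max (crossing (c j) (z j)) 0 :=
    Finset.sum_le_sum fun j _ => le_max_left _ _
  rcases le_total (∑ j, max (crossing (c j) (z j)) 0 - 1) 0 with h | h
  · rw [max_eq_right h] at h2
    refine le_trans ?_ (le_max_right _ _)
    linarith
  · rw [max_eq_left h] at h2
    refine le_trans ?_ (le_max_left _ _)
    linarith

end Excess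

/-! ### Frequencies of the paradox as Haar measures -/

section Probability

lemma mFourier_eq_toCircle {d : Type*} [Fintype d] (k : d → ℤ) (x : UnitAddTorus d) :
    mFourier k x = (AddCircle.toCircle (∑ j, k j • x j) : ℂ) := by
  classical
  simp only [mFourier, ContinuousMap.coe_mk, fourier_apply]
  induction (Finset.univ : Finset d) using Finset.induction_on with
  | empty => simp
  | insert a s ha ih =>
    rw [Finset.prod_insert ha, Finset.sum_insert ha, ih, AddCircle.toCircle_add, Circle.coe_mul]

variable {m : ℕ} {p : Fin m → ℝ}

/-- The step of the orbit on the torus, with the coordinate of state `i` left out. -/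
noncomputable def orbitStep (p : Fin m → ℝ) (i : Fin m) : UnitAddTorus {j // j ≠ i} :=
  fun j => (p j : UnitAddCircle)

/-- The drifts of the other states relative to state `i`. -/
def drift (p : Fin m → ℝ) (i : Fin m) : {j // j ≠ i} → ℝ := fun j => p j - p i

lemma card_ne_add_one (i : Fin m) : Fintype.card {j // j ≠ i} + 1 = m := by
  have := i.pos
  simp; omega

lemma cast_card_ne_add_one (i : Fin m) : (Fintype.card {j // j ≠ i} : ℝ) + 1 = m := by
  exact_mod_cast card_ne_add_one i

/-- A trivial character value makes `∑ k_j p_j` an integer `l`. Extending `k` by zero at `i`, all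
coefficients equal `l`, hence vanish. Omitting `i` is essential: the full vector of sizes has
integer sum. -/
lemma IsIndependentSizes.mFourier_orbitStep_ne_one (hp : IsIndependentSizes p) (i : Fin m)
    (k : {j // j ≠ i} → ℤ) (hk : k ≠ 0) : mFourier k (orbitStep p i) ≠ 1 := by
  intro h
  rw [mFourier_eq_toCircle] at h
  have h1 : ∑ j, k j • orbitStep p i j = 0 := by
    apply AddCircle.injective_toCircle (one_ne_zero (α := ℝ))
    rw [AddCircle.toCircle_zero]
    exact Circle.ext (by rw [h, Circle.coe_one])
  have h2 : ((∑ j, (k j : ℝ) * p j : ℝ) : UnitAddCircle) = 0 := by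
    rw [← h1]
    refine (map_sum (QuotientAddGroup.mk' (AddSubgroup.zmultiples (1 : ℝ)))
      (fun j : {j // j ≠ i} => (k j : ℝ) * p j) Finset.univ).trans ?_
    refine Finset.sum_congr rfl fun j _ => ?_
    rw [← zsmul_eq_mul, map_zsmul]
    rfl
  obtain ⟨l, hl⟩ := exists_intCast_eq_of_coe_eq_zero h2
  set g : Fin m → ℤ := fun j => if hj : j ≠ i then k ⟨j, hj⟩ else 0 with hg
  have hgi : g i = 0 := by simp [hg]
  have hgj : ∀ j : {j // j ≠ i}, g j = k j := fun j => by simp [hg, j.2]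
  have h3 : ∑ j, (g j : ℝ) * p j = l := by
    rw [Fintype.sum_eq_add_sum_subtype_ne _ i, hgi, ← hl]
    simp only [hgj]
    simp
  have hl0 : 0 = l := hgi.symm.trans (hp.eq_of_sum_eq_intCast h3 i)
  refine hk (funext fun j => ?_)
  rw [← hgj, hp.eq_of_sum_eq_intCast h3 j, ← hl0]; rfl

lemma IsIndependentSizes.sum_ne (hp : IsIndependentSizes p) (i : Fin m) :
    ∑ j : {j // j ≠ i}, p j = 1 - p i := by
  rw [← hp.sum_eq_one, Fintype.sum_eq_add_sum_subtype_ne _ i]; ring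

lemma IsIndependentSizes.sum_drift (hp : IsIndependentSizes p) (i : Fin m) :
    ∑ j, drift p i j = 1 - m * p i := by
  simp only [drift, Finset.sum_sub_distrib, hp.sum_ne, Finset.sum_const, Finset.card_univ,
    nsmul_eq_mul]
  linear_combination (-p i) * cast_card_ne_add_one i

lemma IsIndependentSizes.baseCoord_nsmul (hp : IsIndependentSizes p) (i : Fin m) (n : ℕ) :
    baseCoord _ (n • orbitStep p i) = ((n * p i : ℝ) : UnitAddCircle) := by
  have h1 : ∑ j, orbitStep p i j = ((1 - p i : ℝ) : UnitAddCircle) := by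
    rw [← hp.sum_ne i]
    exact (map_sum (QuotientAddGroup.mk' (AddSubgroup.zmultiples (1 : ℝ)))
      (fun j : {j // j ≠ i} => p j) Finset.univ).symm
  have h2 : ((1 : ℝ) : UnitAddCircle) = 0 := AddCircle.coe_period 1
  rw [map_nsmul, baseCoord_apply, h1, AddCircle.coe_sub, h2, zero_sub, neg_neg,
    ← AddCircle.coe_nsmul, nsmul_eq_mul]

lemma IsIndependentSizes.relCoords_nsmul (hp : IsIndependentSizes p) (i : Fin m) (n : ℕ)
    (j : {j // j ≠ i}) :
    relCoords _ (n • orbitStep p i) j = ((n * drift p i j : ℝ) : UnitAddCircle) := by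
  rw [relCoords_apply, hp.baseCoord_nsmul, Pi.smul_apply, orbitStep, ← AddCircle.coe_nsmul,
    ← AddCircle.coe_sub, nsmul_eq_mul, ← mul_sub, drift]

/-- The Alabama paradox is an event on the torus. -/
lemma IsIndependentSizes.suffers_iff_mem (hp : IsIndependentSizes p) (i : Fin m) {n : ℕ}
    (hn : 1 ≤ n) : Suffers p n i ↔ n • orbitStep p i ∈ paradoxSet (drift p i) := by
  have hL : torusLevel (n • orbitStep p i) = level p n i := by
    simp only [torusLevel, level, hp.baseCoord_nsmul, hp.relCoords_nsmul, circleFract_coe,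
      cast_card_ne_add_one]
    rw [Fintype.sum_eq_add_sum_subtype_ne _ i]
    simp [drift]
  -- This identifies `torusLevel + 1 - netCrossing` with the second quantity in `suffers_iff_level`.
  have hW : netCrossing (drift p i) (relCoords _ (n • orbitStep p i))
      = ∑ j, Int.fract (n * drift p i j) + (1 - m * p i)
        - ∑ j, Int.fract (((n + 1 : ℕ) : ℝ) * drift p i j) := by
    have : ∀ j, ((n + 1 : ℕ) : ℝ) * drift p i j = n * drift p i j + drift p i j := fun j => by
      push_cast; ring
    simp only [netCrossing, crossing, hp.relCoords_nsmul, ← AddCircle.coe_add, circleFract_coe,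
      Finset.sum_sub_distrib, Finset.sum_add_distrib, hp.sum_drift, this]
  have hL' : level p n i = m * Int.fract (n * p i) + ∑ j, Int.fract (n * drift p i j) := by
    rw [level, Fintype.sum_eq_add_sum_subtype_ne _ i]
    simp [drift]
  have hS : ∑ j, Int.fract (((n + 1 : ℕ) : ℝ) * (p j - p i))
      = ∑ j, Int.fract (((n + 1 : ℕ) : ℝ) * drift p i j) := by
    rw [Fintype.sum_eq_add_sum_subtype_ne _ i, sub_self, mul_zero, Int.fract_zero, zero_add]
    rfl
  have hc := cast_card_ne_add_one i
  rw [suffers_iff_level hp hn, paradoxSet, Set.mem_ofPred_eq, hL, hW, hS]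
  constructor
  · rintro ⟨h1, h2⟩
    exact ⟨by linarith, by linarith⟩
  · rintro ⟨h1, h2⟩
    exact ⟨by linarith, by linarith⟩

lemma IsIndependentSizes.drift_lt_one (hp : IsIndependentSizes p) (i : Fin m) (j : {j // j ≠ i}) :
    drift p i j < 1 := by
  have h1 := hp.le_one j
  have h2 := hp.pos i
  unfold drift; linarith

/-- The asymptotic frequency of the paradox for state `i`. -/
noncomputable def paradoxProbability (p : Fin m → ℝ) (i : Fin m) : ℝ :=
  excess (drift p i) / m

open scoped Classical in
lemma IsIndependentSizes.tendsto_frequency (hp : IsIndependentSizes p) (i : Fin m) :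
    Tendsto (fun N : ℕ => (((Finset.Icc 1 N).filter fun n => Suffers p n i).card : ℝ) / N) atTop
      (𝓝 (paradoxProbability p i)) := by
  have hsum : ∑ j, drift p i j ≤ 1 := by
    rw [hp.sum_drift]
    have : 0 ≤ m * p i := mul_nonneg (Nat.cast_nonneg m) (hp.nonneg i)
    linarith
  have h := tendsto_orbit_frequency (hp.mFourier_orbitStep_ne_one i)
    (measurableSet_paradoxSet (drift p i)) (measure_frontier_paradoxSet _)
    (fun n => Suffers p n i) (fun n hn => hp.suffers_iff_mem i hn)
  rwa [measureReal_paradoxSet hsum (hp.drift_lt_one i), cast_card_ne_add_one] at h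

lemma IsIndependentSizes.isAlabamaProbability (hp : IsIndependentSizes p) (i : Fin m) :
    IsAlabamaProbability p i (paradoxProbability p i) := by
  classical
  -- `sufferCount` stops at `n < N`; after a shift of `N` by one, the ratio differs by the factor `N
  -- / (N + 1)`.
  rw [IsAlabamaProbability, ← tendsto_add_atTop_iff_nat 1]
  have h := (hp.tendsto_frequency i).mul (tendsto_natCast_div_add_atTop (1 : ℝ))
  rw [mul_one] at h
  refine h.congr' ?_
  filter_upwards [eventually_ge_atTop 1] with N hN
  have hN' : (N : ℝ) ≠ 0 := by positivity
  have : Finset.Ico 1 (N + 1) = Finset.Icc 1 N := by ext; simp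
  rw [sufferCount, this]
  push_cast
  field_simp

lemma IsIndependentSizes.isExpectedNumber (hp : IsIndependentSizes p) :
    IsExpectedNumber p (∑ i, paradoxProbability p i) := by
  classical
  refine (tendsto_finsetSum _ fun i _ => hp.tendsto_frequency i).congr fun N => ?_
  rw [← Finset.sum_div]
  congr 1
  simp only [numSuffering, Finset.card_filter, Nat.cast_sum]
  exact Finset.sum_comm

end Probability

/-! ### Upper and lower bounds against `1/e` -/

section Bounds

variable {m : ℕ} {p : Fin m → ℝ}

lemma IsIndependentSizes.max_drift_le (hp : IsIndependentSizes p) (i : Fin m)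
    (j : {j // j ≠ i}) : max (drift p i j) 0 ≤ p j :=
  max_le (sub_le_self _ (hp.nonneg i)) (hp.nonneg j)

lemma IsIndependentSizes.sum_max_drift_lt_one (hp : IsIndependentSizes p) (i : Fin m) :
    ∑ j, max (drift p i j) 0 < 1 := by
  have h1 := Finset.sum_le_sum fun j (_ : j ∈ Finset.univ) => hp.max_drift_le i j
  rw [hp.sum_ne] at h1
  have h2 := hp.pos i
  linarith

lemma sub_one_add_exp_neg_lt {a : ℝ} (h0 : 0 ≤ a) (h1 : a < 1) :
    a - 1 + Real.exp (-a) < Real.exp (-1) := by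
  have h2 : a < Real.exp (a - 1) := by
    have := Real.add_one_lt_exp (x := a - 1) (by linarith)
    linarith
  have h3 : Real.exp (-1) = Real.exp (-a) * Real.exp (a - 1) := by
    rw [← Real.exp_add]; congr 1; ring
  have h4 : Real.exp (-a) ≤ 1 := Real.exp_le_one_iff.2 (by linarith)
  have h5 := mul_lt_mul_of_pos_left h2 (Real.exp_pos (-a))
  rw [h3]
  -- What remains is `a e^{-a} - (a - 1 + e^{-a}) = (1 - a)(1 - e^{-a}) ≥ 0`.
  nlinarith

lemma IsIndependentSizes.excess_drift_lt (hp : IsIndependentSizes p) (i : Fin m) :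
    excess (drift p i) < Real.exp (-1) := by
  refine (excess_le (hp.drift_lt_one i)).trans_lt ?_
  have h1 : ∏ j, (1 - max (drift p i j) 0) ≤ Real.exp (-∑ j, max (drift p i j) 0) := by
    rw [← Finset.sum_neg_distrib, Real.exp_sum]
    refine Finset.prod_le_prod (fun j _ => ?_) fun j _ => Real.one_sub_le_exp_neg _
    have := hp.max_drift_le i j
    have := hp.le_one j
    linarith
  have h2 := sub_one_add_exp_neg_lt (Finset.sum_nonneg fun j _ => le_max_right (drift p i j) 0)
    (hp.sum_max_drift_lt_one i)
  linarith

lemma IsIndependentSizes.num_states_pos (hp : IsIndependentSizes p) : 0 < m := by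
  rcases Nat.eq_zero_or_pos m with rfl | h
  · have := hp.sum_eq_one
    simp at this
  · exact h

lemma IsIndependentSizes.sum_paradoxProbability_lt (hp : IsIndependentSizes p) :
    ∑ i, paradoxProbability p i < 1 / Real.exp 1 := by
  have hm : (0 : ℝ) < m := by exact_mod_cast hp.num_states_pos
  have : Nonempty (Fin m) := ⟨⟨0, hp.num_states_pos⟩⟩
  simp only [paradoxProbability]
  rw [← Finset.sum_div, div_lt_iff₀ hm, one_div, ← Real.exp_neg]
  refine (Finset.sum_lt_sum_of_nonempty Finset.univ_nonempty
    fun i _ => hp.excess_drift_lt i).trans_eq ?_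
  simp [mul_comm]

/-- A converse to `1 - a ≤ e^{-a}`, at the price of the factor `1 / (1 - δ)` in the exponent; it
bounds the product from below. -/
lemma exp_neg_div_le_one_sub {a δ : ℝ} (h0 : 0 ≤ a) (h1 : a ≤ δ) (h2 : δ < 1) :
    Real.exp (-(a / (1 - δ))) ≤ 1 - a := by
  have hδ : 0 < 1 - δ := by linarith
  have h3 : 1 + a / (1 - δ) ≤ Real.exp (a / (1 - δ)) := by
    have := Real.add_one_le_exp (a / (1 - δ)); linarith
  have h4 : 0 < 1 + a / (1 - δ) := by positivity
  rw [Real.exp_neg]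
  refine (inv_anti₀ h4 h3).trans ?_
  rw [inv_le_iff_one_le_mul₀ h4]
  have h5 : (1 - a) * (1 + a / (1 - δ)) = 1 + a * (δ - a) / (1 - δ) := by
    field_simp; ring
  rw [h5]
  have : 0 ≤ a * (δ - a) / (1 - δ) :=
    div_nonneg (mul_nonneg h0 (by linarith)) hδ.le
  linarith

/-- In `le_excess` the linear part is `∑ c_j - 1 = -m p_i ≥ -δ`, and the exponents in the product
add up to at most `1 / (1 - δ)`. -/
lemma IsIndependentSizes.le_excess_drift (hp : IsIndependentSizes p) {δ : ℝ} (hδ1 : δ < 1)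
    (hδ : ∀ j, p j ≤ δ) {i : Fin m} (hi : m * p i ≤ δ) :
    Real.exp (-(1 / (1 - δ))) - δ ≤ excess (drift p i) := by
  have hδ' : 0 < 1 - δ := by linarith
  have h1 : Real.exp (-(1 / (1 - δ))) ≤ ∏ j, (1 - max (drift p i j) 0) := by
    calc Real.exp (-(1 / (1 - δ)))
        ≤ Real.exp (∑ j, -(max (drift p i j) 0 / (1 - δ))) := by
          rw [Finset.sum_neg_distrib, ← Finset.sum_div]
          refine Real.exp_le_exp.2 (neg_le_neg ?_)
          exact div_le_div_of_nonneg_right (hp.sum_max_drift_lt_one i).le hδ'.le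
      _ = ∏ j, Real.exp (-(max (drift p i j) 0 / (1 - δ))) := Real.exp_sum _ _
      _ ≤ _ := Finset.prod_le_prod (fun j _ => (Real.exp_pos _).le) fun j _ =>
          exp_neg_div_le_one_sub (le_max_right _ _) ((hp.max_drift_le i j).trans (hδ j)) hδ1
  have h2 := le_excess (hp.drift_lt_one i)
  rw [hp.sum_drift] at h2
  linarith

lemma IsIndependentSizes.le_sum_paradoxProbability (hp : IsIndependentSizes p) {δ : ℝ}
    (hδ1 : δ < 1) (hδ : ∀ j, p j ≤ δ) {s : Finset (Fin m)}
    (hs : ∀ i ∈ s, p i ≤ δ / m) :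
    (1 - (sᶜ.card : ℝ) / m) * (Real.exp (-(1 / (1 - δ))) - δ) ≤ ∑ i, paradoxProbability p i := by
  have hm : (0 : ℝ) < m := by exact_mod_cast hp.num_states_pos
  simp only [paradoxProbability]
  rw [← Finset.sum_div, le_div_iff₀ hm]
  have hcard : ((s.card : ℝ) + sᶜ.card) = m := by
    have := Finset.card_add_card_compl s
    rw [Fintype.card_fin] at this
    exact_mod_cast this
  have h1 : (1 - (sᶜ.card : ℝ) / m) * m = s.card := by
    rw [sub_mul, div_mul_cancel₀ _ hm.ne']; linarith
  calc (1 - (sᶜ.card : ℝ) / m) * (Real.exp (-(1 / (1 - δ))) - δ) * m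
      = ∑ _i ∈ s, (Real.exp (-(1 / (1 - δ))) - δ) := by
        rw [mul_right_comm, h1, Finset.sum_const, nsmul_eq_mul]
    _ ≤ ∑ i ∈ s, excess (drift p i) := Finset.sum_le_sum fun i hi =>
        hp.le_excess_drift hδ1 hδ (by
          have := (le_div_iff₀ hm).1 (hs i hi); linarith)
    _ ≤ ∑ i, excess (drift p i) := Finset.sum_le_sum_of_subset_of_nonneg (Finset.subset_univ s)
        fun i _ _ => excess_nonneg _

end Bounds

end Hamilton

theorem mainTheorem2 :
    -- existence of the limits and the strict upper bound
    (∀ (m : ℕ) (p : Fin m → ℝ), Hamilton.IsIndependentSizes p →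
      ∃ q : Fin m → ℝ,
        (∀ i, Hamilton.IsAlabamaProbability p i (q i)) ∧
        Hamilton.IsExpectedNumber p (∑ i, q i) ∧
        ∑ i, q i < 1 / Real.exp 1) ∧
    -- the bound is approached: `small k` are the very small states of the `k`-th system
    (∀ (m : ℕ → ℕ) (p : (k : ℕ) → Fin (m k) → ℝ) (small : (k : ℕ) → Finset (Fin (m k)))
      (E : ℕ → ℝ),
      Tendsto m atTop atTop →
      (∀ k, Hamilton.IsIndependentSizes (p k)) →
      Tendsto (fun k => (((small k)ᶜ.card : ℕ) : ℝ) / (m k : ℝ)) atTop (𝓝 0) →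
      (∀ ε : ℝ, 0 < ε → ∀ᶠ k in atTop, ∀ i ∈ small k, p k i ≤ ε / (m k : ℝ)) →
      (∀ ε : ℝ, 0 < ε → ∀ᶠ k in atTop, ∀ i ∉ small k, p k i ≤ ε) →
      (∀ k, Hamilton.IsExpectedNumber (p k) (E k)) →
      Tendsto E atTop (𝓝 (1 / Real.exp 1))) := by
  refine ⟨fun m p hp => ⟨Hamilton.paradoxProbability p, hp.isAlabamaProbability,
    hp.isExpectedNumber, hp.sum_paradoxProbability_lt⟩, ?_⟩
  intro m p small E _ hp hcard hsmall hlarge hE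
  have hEq : ∀ k, E k = ∑ i, Hamilton.paradoxProbability (p k) i := fun k =>
    tendsto_nhds_unique (hE k) (hp k).isExpectedNumber
  rw [tendsto_order]
  -- The upper half is part (i), valid for every `k`; only the lower half needs the asymptotic
  -- regime.
  refine ⟨fun a ha => ?_, fun a ha => Eventually.of_forall fun k => ?_⟩
  · have hcont : Tendsto (fun δ : ℝ => Real.exp (-(1 / (1 - δ))) - δ) (𝓝 0)
        (𝓝 (1 / Real.exp 1)) := by
      have : ContinuousAt (fun δ : ℝ => Real.exp (-(1 / (1 - δ))) - δ) 0 := by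
        refine ContinuousAt.sub (Real.continuous_exp.continuousAt.comp ?_) continuousAt_id
        exact (continuousAt_const.div (continuousAt_const.sub continuousAt_id) (by simp)).neg
      have h := this.tendsto
      simpa [Real.exp_neg] using h
    -- One `δ` serves as the bound on all sizes and on `m p_i` for the very small states.
    obtain ⟨δ, hδa, hδ1, hδ0⟩ : ∃ δ : ℝ, a < Real.exp (-(1 / (1 - δ))) - δ ∧ δ < 1 ∧ 0 < δ := by
      have h1 : ∀ᶠ δ in 𝓝[>] (0 : ℝ), a < Real.exp (-(1 / (1 - δ))) - δ :=
        (hcont.mono_left nhdsWithin_le_nhds).eventually (lt_mem_nhds ha)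
      have h2 : ∀ᶠ δ in 𝓝[>] (0 : ℝ), δ < 1 :=
        nhdsWithin_le_nhds (gt_mem_nhds one_pos)
      exact (h1.and (h2.and self_mem_nhdsWithin)).exists
    have hlim : Tendsto (fun k => (1 - (((small k)ᶜ.card : ℕ) : ℝ) / (m k : ℝ))
        * (Real.exp (-(1 / (1 - δ))) - δ)) atTop (𝓝 (Real.exp (-(1 / (1 - δ))) - δ)) := by
      simpa using (hcard.const_sub 1).mul_const (Real.exp (-(1 / (1 - δ))) - δ)
    filter_upwards [hlim.eventually (lt_mem_nhds hδa), hsmall δ hδ0, hlarge δ hδ0]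
      with k h1 h2 h3
    rw [hEq]
    refine h1.trans_le ((hp k).le_sum_paradoxProbability hδ1 (fun j => ?_) h2)
    by_cases hj : j ∈ small k
    · have hm : (1 : ℝ) ≤ m k := by exact_mod_cast (hp k).num_states_pos
      exact (h2 j hj).trans (div_le_self hδ0.le hm)
    · exact h3 j hj
  · rw [hEq]
    exact (hp k).sum_paradoxProbability_lt.trans ha
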